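/- **Definitions.** Graphs are simple and finite. For $k\ge 1$ write $[k]=\{1,\dots,k\}$. An *NLC-decomposition tree of width $k$* is a rooted binary tree in which every leaf is labeled $\mathsf{newVertex}_i$ for some $i\in[k]$ (it creates one vertex of color $i$), and every internal node has an ordered pair of children and carries a set $S\subseteq[k]\times[k]$ and a function $R:[k]\to[k]$: from the colored graphs $G'$ and $G''$ constructed at its left and right child it constructs the disjoint union of $G'$ and $G''$, adds an edge between every vertex of color $i$ of $G'$ and every vertex of color $j$ of $G''$ for all $(i,j)\in S$, and then recolors every vertex of color $i$ with $R(i)$, for all $i\in[k]$ simultaneously. (The case $S=\varnothing$ is the disjoint union $\parallel$, and $R=\mathrm{id}$ means no recoloring.) It is a tree of $G$ if the graph constructed at its root is $G$, up to isomorphism. The *NLC-width* of $G$ is the smallest $k$ for which $G$ has an NLC-decomposition tree of width $k$. An *NLC$_+$-decomposition tree of width $k$* is a rooted tree such that (1) every leaf is labeled $\mathsf{newVertex}_i$ for some $i\in[k]$; (2) every internal node is labeled $\Join$ or $\parallel$; (3) every $\Join$ node has exactly two children, which are ordered, and carries a set $S\subseteq[k]\times[k]$ and a function $R:[k]\to[k]$,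 with the same meaning as above; (4) every $\parallel$ node has an arbitrary number, at least two, of children, its colored graph is the disjoint union of those of its children, and, unless it is the root, its parent is a $\Join$ node; (5) for every $\Join$ node, the graph constructed by the subtree rooted at it is connected. The *depth* of a rooted tree is the number of edges of a longest path from the root to a leaf. **Statement.** 1. There is a constant $C$ such that, for every $k\ge1$ and every $n\geq 1$, every connected $n$-vertex graph of NLC-width $k$ has an NLC$_+$-decomposition tree of width at most $k\cdot 2^{k+1}$ and of depth at most $C\log n$. 2. If a connected graph $G$ has an NLC-decomposition tree $T$ of width $w$ and depth $d$, then $G$ has an NLC$_+$-decomposition tree $T_+$ of width $w$ and depth at most $2d$ such that every vertex of $G$ has the same color at the root of $T_+$ as at the root of $T$. -/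

import Mathlib

/-- The operation `⋈_S` on an ordered pair of vertex-disjoint colored graphs `(G, c)`, `(H, d)`:
the disjoint union of `G` and `H`, together with all edges between a vertex of color `i` of `G` and
a vertex of color `j` of `H`, for `(i, j) ∈ S`. -/
def joinGraph {A B : Type} {k : ℕ} (S : Set (Fin k × Fin k))
    (G : SimpleGraph A) (c : A → Fin k) (H : SimpleGraph B) (d : B → Fin k) :
    SimpleGraph (A ⊕ B) where
  Adj
    | Sum.inl a, Sum.inl a' => G.Adj a a'
    | Sum.inr b, Sum.inr b' => H.Adj b b'
    | Sum.inl a, Sum.inr b => (c a, d b) ∈ S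
    | Sum.inr b, Sum.inl a => (c a, d b) ∈ S
  symm := ⟨by
    rintro (a | b) (a' | b') h
    · exact SimpleGraph.Adj.symm h
    · exact h
    · exact h
    · exact SimpleGraph.Adj.symm h⟩
  loopless := ⟨by
    rintro (a | b) h
    · exact G.loopless.irrefl a h
    · exact H.loopless.irrefl b h⟩

/-- The disjoint union of a family of graphs. -/
def parallelGraph {ι : Type} {A : ι → Type} (G : ∀ i, SimpleGraph (A i)) :
    SimpleGraph (Σ i, A i) where
  Adj x y := ∃ i a b, x = ⟨i, a⟩ ∧ y = ⟨i, b⟩ ∧ (G i).Adj a b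
  symm := ⟨by
    rintro x y ⟨i, a, b, hx, hy, h⟩
    exact ⟨i, b, a, hy, hx, SimpleGraph.Adj.symm h⟩⟩
  loopless := ⟨by
    rintro x ⟨i, a, b, hx, hy, h⟩
    have hab : a = b := by simpa using hx.symm.trans hy
    subst hab
    exact (G i).loopless.irrefl a h⟩

/-- NLC-decomposition trees with colors in `[k]`. A leaf creates a vertex with a color; an internal
node has an ordered pair of children, and it performs a join `⋈_S` followed by a recoloring `R`.
The choice `S = ∅` is the label `∥`, and `R = id` means that there is no recoloring. -/
inductive NLCTree (k : ℕ) : Type where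
  | newVertex (i : Fin k) : NLCTree k
  | join (S : Set (Fin k × Fin k)) (R : Fin k → Fin k) (l r : NLCTree k) : NLCTree k

namespace NLCTree

variable {k : ℕ}

/-- The set of leaves of the tree; these are the vertices of the constructed graph. -/
def Leaf : NLCTree k → Type
  | newVertex _ => Unit
  | join _ _ l r => l.Leaf ⊕ r.Leaf

/-- The colors of the vertices at the root of the tree. -/
def color : (T : NLCTree k) → T.Leaf → Fin k
  | newVertex i => fun _ => i
  | join _ R l r => Sum.elim (R ∘ l.color) (R ∘ r.color)

/-- The graph constructed by the tree. -/
def graph : (T : NLCTree k) → SimpleGraph T.Leaf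
  | newVertex _ => (⊥ : SimpleGraph Unit)
  | join S _ l r => joinGraph S l.graph l.color r.graph r.color

/-- The number of edges of a longest path from the root to a leaf. -/
def depth : NLCTree k → ℕ
  | newVertex _ => 0
  | join _ _ l r => max l.depth r.depth + 1

end NLCTree

/-- The NLC-width of a graph: the smallest `k` such that the graph can be constructed, up to
isomorphism, by an NLC-decomposition tree with colors in `[k]`. (Every nonempty finite graph has
such a tree for some `k ≥ 1`; if there is no such tree, then the value is `0`.) -/
noncomputable def nlcWidth {V : Type*} (G : SimpleGraph V) : ℕ :=
  sInf {k | ∃ T : NLCTree k, Nonempty (T.graph ≃g G)}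

/-- Rooted trees with leaves labeled `newVertex i`, binary nodes labeled `⋈` (with a set `S` and a
recoloring function `R`), and nodes labeled `∥` of any arity `p`, all with colors in `[k]`. -/
inductive NLCPlusTree (k : ℕ) : Type where
  | newVertex (i : Fin k) : NLCPlusTree k
  | join (S : Set (Fin k × Fin k)) (R : Fin k → Fin k) (l r : NLCPlusTree k) : NLCPlusTree k
  | parallel (p : ℕ) (child : Fin p → NLCPlusTree k) : NLCPlusTree k

namespace NLCPlusTree

variable {k : ℕ}

/-- The set of leaves of the tree; these are the vertices of the constructed graph. -/
def Leaf : NLCPlusTree k → Type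
  | newVertex _ => Unit
  | join _ _ l r => l.Leaf ⊕ r.Leaf
  | parallel _ child => Σ j, (child j).Leaf

/-- The colors of the vertices at the root of the tree. -/
def color : (T : NLCPlusTree k) → T.Leaf → Fin k
  | newVertex i => fun _ => i
  | join _ R l r => Sum.elim (R ∘ l.color) (R ∘ r.color)
  | parallel _ child => fun x => (child x.1).color x.2

/-- The graph constructed by the tree. -/
def graph : (T : NLCPlusTree k) → SimpleGraph T.Leaf
  | newVertex _ => (⊥ : SimpleGraph Unit)
  | join S _ l r => joinGraph S l.graph l.color r.graph r.color
  | parallel _ child => parallelGraph fun j => (child j).graph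

/-- The number of edges of a longest path from the root to a leaf. -/
def depth : NLCPlusTree k → ℕ
  | newVertex _ => 0
  | join _ _ l r => max l.depth r.depth + 1
  | parallel _ child => (Finset.univ.sup fun j => (child j).depth) + 1

/-- The root of the tree is labeled `∥`. -/
def IsParallel : NLCPlusTree k → Prop
  | parallel _ _ => True
  | _ => False

/-- The conditions that make the tree an NLC₊-decomposition tree of width `k`: every `∥` node has at
least two children, none of which is a `∥` node (so the parent of a `∥` node other than the root is
a `⋈` node), and the graph constructed by the subtree rooted at any `⋈` node is connected. -/
def IsDecomposition : NLCPlusTree k → Prop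
  | newVertex _ => True
  | join S R l r => (join S R l r).graph.Connected ∧ l.IsDecomposition ∧ r.IsDecomposition
  | parallel p child => 2 ≤ p ∧ ∀ j, ¬ (child j).IsParallel ∧ (child j).IsDecomposition

end NLCPlusTree

/-! Both statements are proved for trees over subsets of the fixed vertex set `V` (`Built`).

Statement 1 balances a tree. Cut out the part `B` built by a subtree and give each vertex outside
`B` its own color together with its profile, the set of colors of its neighbors in `B`. Vertices of
`B` of equal color look alike from outside, so the profile records all edges to `B`, and contexts
compose with one join (`BalancedContext.trans`). A Boolean tag keeps the two sides of that join
apart, whence `2 * k * 2 ^ k` colors. Cutting at a vertex where the size drops below half gives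
depth logarithmic in the number of vertices (`balancedContext_of_ncard_le`).

Statement 2 replaces each subtree by trees for the connected components of its graph. A component
`K` of a join of `L` and `R` meets each side in a union of components of that side, so one `∥` level
and one `⋈` level suffice per original level (`Built.plusBuiltConnected`). Statement 1 applies this
to the balanced tree. -/

/-! ### Decomposition trees over vertex subsets -/

/-- The colored graph `(H, col)` is isomorphic to the subgraph of `G` induced on `A`, colored
by `c`. -/
def RealizedOn {X V κ : Type*} (H : SimpleGraph X) (col : X → κ) (G : SimpleGraph V)
    (A : Set V) (c : V → κ) : Prop :=
  ∃ e : H ↪g G, Set.range e = A ∧ ∀ x, col x = c (e x)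

/-- The set `A`, colored by `a`, arises from the disjoint sets `L` and `R`, colored by `l` and `r`,
by a join operation followed by a recoloring. -/
structure IsJoin {V κ : Type*} (G : SimpleGraph V) (A : Set V) (a : V → κ)
    (L : Set V) (l : V → κ) (R : Set V) (r : V → κ) : Prop where
  disjoint : Disjoint L R
  union_eq : A = L ∪ R
  adj : ∃ S : Set (κ × κ), ∀ x ∈ L, ∀ y ∈ R, G.Adj x y ↔ (l x, r y) ∈ S
  color : ∃ f : κ → κ, (∀ x ∈ L, a x = f (l x)) ∧ ∀ x ∈ R, a x = f (r x)

theorem IsJoin.symm {V κ : Type*} {G : SimpleGraph V} {A L R : Set V} {a l r : V → κ}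
    (h : IsJoin G A a L l R r) : IsJoin G A a R r L l := by
  obtain ⟨hd, hu, ⟨S, hS⟩, f, hl, hr⟩ := h
  refine ⟨hd.symm, by rw [hu, Set.union_comm], ⟨{p | p.swap ∈ S}, fun x hx y hy => ?_⟩, f, hr, hl⟩
  rw [G.adj_comm, hS y hy x hx]
  rfl

/-- The subgraph of `G` induced on `A`, colored by `c`, has a decomposition tree of depth at
most `d`. -/
inductive Built {V κ : Type*} (G : SimpleGraph V) : ℕ → Set V → (V → κ) → Prop
  | single (d : ℕ) (v : V) (c : V → κ) : Built G d {v} c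
  | join {d : ℕ} {A L R : Set V} {a l r : V → κ} (h : IsJoin G A a L l R r)
      (hl : Built G d L l) (hr : Built G d R r) : Built G (d + 1) A a

namespace Built

variable {V κ : Type*} {G : SimpleGraph V}

theorem mono {d d' : ℕ} {A : Set V} {c : V → κ} (h : Built G d A c) (hd : d ≤ d') :
    Built G d' A c := by
  induction h generalizing d' with
  | single d v c => exact single _ _ _
  | join h _ _ ihl ihr =>
    obtain ⟨e, rfl⟩ : ∃ e, d' = e + 1 := ⟨d' - 1, by omega⟩
    exact join h (ihl (by omega)) (ihr (by omega))

theorem nonempty {d : ℕ} {A : Set V} {c : V → κ} (h : Built G d A c) : A.Nonempty := by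
  induction h with
  | single d v c => exact Set.singleton_nonempty v
  | join h _ _ ihl _ => rw [h.union_eq]; exact ihl.inl

/-- Costs no depth: the map is absorbed by the recoloring at the root, or by the choice of color at
a leaf. -/
theorem recolor {d : ℕ} {A : Set V} {c c' : V → κ} (h : Built G d A c) (g : κ → κ)
    (hg : ∀ x ∈ A, c' x = g (c x)) : Built G d A c' := by
  cases h with
  | single d v c => exact single _ _ _
  | join h hl hr =>
    obtain ⟨hd, hu, hS, f, hfl, hfr⟩ := h
    refine join ⟨hd, hu, hS, g ∘ f, fun x hx => ?_, fun x hx => ?_⟩ hl hr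
    · rw [hg x (hu ▸ Or.inl hx), hfl x hx]; rfl
    · rw [hg x (hu ▸ Or.inr hx), hfr x hx]; rfl

theorem mapEquiv {κ' : Type*} (φ : κ ≃ κ') {d : ℕ} {A : Set V} {c : V → κ} (h : Built G d A c) :
    Built G d A (φ ∘ c) := by
  induction h with
  | single d v c => exact single _ _ _
  | join h _ _ ihl ihr =>
    obtain ⟨hd, hu, ⟨S, hS⟩, f, hfl, hfr⟩ := h
    refine join ⟨hd, hu, ⟨{p | (φ.symm p.1, φ.symm p.2) ∈ S}, fun x hx y hy => ?_⟩,
      φ ∘ f ∘ φ.symm, fun x hx => ?_, fun x hx => ?_⟩ ihl ihr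
    · simp [hS x hx y hy]
    · simp [hfl x hx]
    · simp [hfr x hx]

end Built

theorem RealizedOn.join {V : Type*} {k : ℕ} {X Y : Type} {H : SimpleGraph X} {K : SimpleGraph Y}
    {c : X → Fin k} {d : Y → Fin k} {G : SimpleGraph V} {P L R : Set V} {p l r : V → Fin k}
    {S : Set (Fin k × Fin k)} {f : Fin k → Fin k}
    (hd : Disjoint L R) (hu : P = L ∪ R)
    (hS : ∀ x ∈ L, ∀ y ∈ R, G.Adj x y ↔ (l x, r y) ∈ S)
    (hfl : ∀ x ∈ L, p x = f (l x)) (hfr : ∀ x ∈ R, p x = f (r x))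
    (hl : RealizedOn H c G L l) (hr : RealizedOn K d G R r) :
    RealizedOn (joinGraph S H c K d) (Sum.elim (f ∘ c) (f ∘ d)) G P p := by
  obtain ⟨e, rfl, he⟩ := hl
  obtain ⟨e', rfl, he'⟩ := hr
  have hne : ∀ x y, e x ≠ e' y := fun x y h =>
    Set.disjoint_left.1 hd (Set.mem_range_self x) (h ▸ Set.mem_range_self y)
  refine ⟨⟨⟨Sum.elim e e', ?_⟩, ?_⟩, ?_, ?_⟩
  · exact e.injective.sumElim e'.injective hne
  · rintro (x | x) (y | y)
    · exact e.map_adj_iff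
    · change G.Adj (e x) (e' y) ↔ (c x, d y) ∈ S
      rw [hS _ (Set.mem_range_self x) _ (Set.mem_range_self y), he, he']
    · change G.Adj (e' x) (e y) ↔ (c y, d x) ∈ S
      rw [G.adj_comm, hS _ (Set.mem_range_self y) _ (Set.mem_range_self x), he, he']
    · exact e'.map_adj_iff
  · rw [hu]; exact Set.Sum.elim_range e e'
  · rintro (x | x)
    · change f (c x) = p (e x)
      rw [hfl _ (Set.mem_range_self x), he]
    · change f (d x) = p (e' x)
      rw [hfr _ (Set.mem_range_self x), he']

theorem RealizedOn.single {V κ : Type*} (G : SimpleGraph V) (v : V) (c : V → κ) :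
    RealizedOn (⊥ : SimpleGraph Unit) (fun _ => c v) G {v} c :=
  ⟨⟨⟨fun _ => v, fun _ _ _ => rfl⟩, by simp⟩, Set.range_const, fun _ => rfl⟩

theorem NLCTree.built {V : Type*} {k : ℕ} {G : SimpleGraph V} (T : NLCTree k) {A : Set V}
    {c : V → Fin k} (h : RealizedOn T.graph T.color G A c) : Built G T.depth A c := by
  induction T generalizing A c with
  | newVertex i =>
    obtain ⟨e, rfl, he⟩ := h
    have : Set.range e = {e ()} := by
      ext x
      exact ⟨fun ⟨y, hy⟩ => hy ▸ rfl, fun hx => ⟨(), hx.symm⟩⟩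
    rw [this]
    exact .single _ _ _
  | join S f T U ihT ihU =>
    obtain ⟨e, rfl, he⟩ := h
    let eT : T.graph ↪g G := ⟨⟨fun x => e (Sum.inl x), fun x y hxy =>
      Sum.inl_injective (e.injective hxy)⟩,
      fun {x y} => e.map_adj_iff (v := Sum.inl x) (w := Sum.inl y)⟩
    let eU : U.graph ↪g G := ⟨⟨fun x => e (Sum.inr x), fun x y hxy =>
      Sum.inr_injective (e.injective hxy)⟩,
      fun {x y} => e.map_adj_iff (v := Sum.inr x) (w := Sum.inr y)⟩
    -- Colorings live on all of `V`; the values of `c` off the range are never used.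
    have hT : ∀ x, T.color x = Function.extend eT T.color c (eT x) :=
      fun x => (eT.injective.extend_apply _ _ x).symm
    have hU : ∀ x, U.color x = Function.extend eU U.color c (eU x) :=
      fun x => (eU.injective.extend_apply _ _ x).symm
    refine Built.join ⟨?_, ?_, ⟨S, ?_⟩, f, ?_, ?_⟩
      ((ihT ⟨eT, rfl, hT⟩).mono (le_max_left _ _)) ((ihU ⟨eU, rfl, hU⟩).mono (le_max_right _ _))
    · rw [Set.disjoint_left]
      rintro _ ⟨x, rfl⟩ ⟨y, hy⟩
      exact Sum.inr_ne_inl (e.injective hy)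
    · ext v
      constructor
      · rintro ⟨x | x, rfl⟩
        exacts [Or.inl ⟨x, rfl⟩, Or.inr ⟨x, rfl⟩]
      · rintro (⟨x, rfl⟩ | ⟨x, rfl⟩)
        exacts [⟨Sum.inl x, rfl⟩, ⟨Sum.inr x, rfl⟩]
    · rintro _ ⟨x, rfl⟩ _ ⟨y, rfl⟩
      rw [← hT, ← hU]
      exact e.map_adj_iff (v := Sum.inl x) (w := Sum.inr y)
    · rintro _ ⟨x, rfl⟩
      rw [← hT]
      exact (he (Sum.inl x)).symm
    · rintro _ ⟨x, rfl⟩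
      rw [← hU]
      exact (he (Sum.inr x)).symm

/-! ### Profiles, parts and contexts -/

/-- The set of colors, with respect to `b`, of the neighbors of `x` in `B`. -/
def profile {V κ : Type*} (G : SimpleGraph V) (B : Set V) (b : V → κ) (x : V) : Set κ :=
  {i | ∃ y ∈ B, b y = i ∧ G.Adj x y}

/-- The colored set `(B, b)` is a part of the colored set `(A, a)` from whose outside vertices of
equal color cannot be told apart. -/
structure IsPart {V κ : Type*} (G : SimpleGraph V) (A : Set V) (a : V → κ) (B : Set V)
    (b : V → κ) : Prop where
  subset : B ⊆ A
  color : ∃ f : κ → κ, ∀ y ∈ B, a y = f (b y)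
  adj : ∀ x ∈ A \ B, ∀ y ∈ B, ∀ z ∈ B, b y = b z → G.Adj x y → G.Adj x z

namespace IsPart

variable {V κ : Type*} {G : SimpleGraph V} {A B D : Set V} {a b d : V → κ}

theorem refl (G : SimpleGraph V) (A : Set V) (a : V → κ) : IsPart G A a A a :=
  ⟨subset_rfl, ⟨id, fun _ _ => rfl⟩, fun _ hx => absurd hx.1 hx.2⟩

theorem empty (G : SimpleGraph V) (A : Set V) (a b : V → κ) : IsPart G A a ∅ b :=
  ⟨Set.empty_subset _, ⟨id, fun _ h => h.elim⟩, fun _ _ _ h => h.elim⟩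

theorem trans (h : IsPart G A a B b) (h' : IsPart G B b D d) : IsPart G A a D d := by
  obtain ⟨f, hf⟩ := h.color
  obtain ⟨g, hg⟩ := h'.color
  refine ⟨h'.subset.trans h.subset, ⟨f ∘ g, fun y hy => ?_⟩, fun x hx y hy z hz hyz hxy => ?_⟩
  · rw [hf y (h'.subset hy), hg y hy]; rfl
  · by_cases hxB : x ∈ B
    · exact h'.adj x ⟨hxB, hx.2⟩ y hy z hz hyz hxy
    · exact h.adj x ⟨hx.1, hxB⟩ y (h'.subset hy) z (h'.subset hz) (by rw [hg y hy, hg z hz, hyz]) hxy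

theorem mem_profile_iff (h : IsPart G A a B b) {x y : V} (hx : x ∈ A \ B) (hy : y ∈ B) :
    b y ∈ profile G B b x ↔ G.Adj x y :=
  ⟨fun ⟨z, hz, hzy, hxz⟩ => h.adj x hx z hz y hy hzy hxz, fun h' => ⟨y, hy, rfl, h'⟩⟩

end IsPart

theorem IsJoin.isPart {V κ : Type*} {G : SimpleGraph V} {A L R : Set V} {a l r : V → κ}
    (h : IsJoin G A a L l R r) : IsPart G A a L l := by
  obtain ⟨hd, rfl, ⟨S, hS⟩, f, hl, hr⟩ := h
  refine ⟨Set.subset_union_left, ⟨f, hl⟩, fun x hx y hy z hz hyz => ?_⟩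
  have hxR : x ∈ R := hx.1.resolve_left hx.2
  rw [G.adj_comm, G.adj_comm x, hS y hy x hxR, hS z hz x hxR, hyz]
  exact id

/-- As `Built`, with two copies of every color, of which one is used at the root, and such that the
set may be empty. -/
def TaggedBuilt {V κ : Type*} (G : SimpleGraph V) (m : ℕ) (A : Set V) (c : V → κ) : Prop :=
  A = ∅ ∨ Built G m A fun x => (false, c x)

namespace TaggedBuilt

variable {V κ : Type*} {G : SimpleGraph V} {m : ℕ}

theorem mono {m' : ℕ} {A : Set V} {c : V → κ} (h : TaggedBuilt G m A c) (hm : m ≤ m') :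
    TaggedBuilt G m' A c :=
  h.imp id fun h => h.mono hm

theorem recolor {A : Set V} {c c' : V → κ} (h : TaggedBuilt G m A c) (g : κ → κ)
    (hg : ∀ x ∈ A, c' x = g (c x)) : TaggedBuilt G m A c' :=
  h.imp id fun h => h.recolor (Prod.map id g) fun x hx => by simp [hg x hx]

theorem union {A B : Set V} {a b c : V → κ} (hA : TaggedBuilt G m A a) (hB : TaggedBuilt G m B b)
    (hd : Disjoint A B) {S : Set (κ × κ)}
    (hS : ∀ x ∈ A, ∀ y ∈ B, G.Adj x y ↔ (a x, b y) ∈ S) {f g : κ → κ}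
    (hf : ∀ x ∈ A, c x = f (a x)) (hg : ∀ x ∈ B, c x = g (b x)) :
    TaggedBuilt G (m + 1) (A ∪ B) c := by
  rcases hA with rfl | hA
  · rw [Set.empty_union]
    exact (hB.recolor g hg).mono (Nat.le_succ m)
  rcases hB with rfl | hB'
  · rw [Set.union_empty]
    exact (recolor (.inr hA) f hf).mono (Nat.le_succ m)
  -- The tag tells the sides apart, so that `f` and `g` can act independently in a single
  -- recoloring; that recoloring resets every tag to `false`.
  have hB'' : Built G m B fun x => (true, b x) := hB'.recolor (Prod.map (fun _ => true) id)
    fun _ _ => rfl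
  refine .inr (.join (l := fun x => (false, a x)) (r := fun x => (true, b x)) ⟨hd, rfl, ⟨{p | (p.1.2, p.2.2) ∈ S}, hS⟩,
   
    fun p => (false, bif p.1 then g p.2 else f p.2), fun x hx => ?_, fun x hx => ?_⟩ hA hB'')
  · simp [hf x hx]
  · simp [hg x hx]

end TaggedBuilt

/-- The part of `(A, a)` outside of `(B, b)`, with the information about the edges to `B` in the
colors, has a decomposition tree of depth at most `m`. -/
def BalancedContext {V κ : Type*} (G : SimpleGraph V) (m : ℕ) (A : Set V) (a : V → κ)
    (B : Set V) (b : V → κ) : Prop :=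
  TaggedBuilt G m (A \ B) fun x => (a x, profile G B b x)

namespace BalancedContext

variable {V κ : Type*} {G : SimpleGraph V} {m : ℕ} {A B D : Set V} {a b d : V → κ}

/-- The profiles in `B` determine both the edges from `A \ B` to `B \ D` and, through the map `g`
from colors of `D` to colors of `B`, the profiles in `D`. One join therefore combines the two
contexts. -/
theorem trans (h : BalancedContext G m A a B b) (h' : BalancedContext G m B b D d)
    (hAB : IsPart G A a B b) (hBD : IsPart G B b D d) : BalancedContext G (m + 1) A a D d := by
  obtain ⟨f, hf⟩ := hAB.color
  obtain ⟨g, hg⟩ := hBD.color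
  have hu : A \ D = A \ B ∪ B \ D := by
    ext x
    have := @hAB.subset x
    have := @hBD.subset x
    simp only [Set.mem_union, Set.mem_sdiff]
    tauto
  rw [BalancedContext, hu]
  refine TaggedBuilt.union h h' ?_ (S := {p | p.2.1 ∈ p.1.2})
    -- A profile contains only colors that occur in `D`, hence the condition `i ∈ d '' D`.
    (f := fun p => (p.1, {i | i ∈ d '' D ∧ g i ∈ p.2})) (g := fun p => (f p.1, p.2)) ?_ ?_ ?_
  · exact Set.disjoint_left.2 fun x hx hx' => hx.2 hx'.1
  · exact fun x hx y hy => (hAB.mem_profile_iff hx hy.1).symm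
  · intro x hx
    refine Prod.ext rfl (Set.ext fun i => ?_)
    constructor
    · rintro ⟨y, hy, rfl, hxy⟩
      refine ⟨⟨y, hy, rfl⟩, ?_⟩
      rw [← hg y hy]
      exact (hAB.mem_profile_iff hx (hBD.subset hy)).2 hxy
    · rintro ⟨⟨y, hy, rfl⟩, hi⟩
      rw [← hg y hy] at hi
      exact ⟨y, hy, rfl, (hAB.mem_profile_iff hx (hBD.subset hy)).1 hi⟩
  · exact fun x hx => Prod.ext (hf x hx.1) rfl

/-- The context of one child is its sibling `R`, and the profile of a vertex of `R` in `L` depends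
only on its color. -/
theorem of_isJoin {A L R : Set V} {a l r c : V → κ} (h : IsJoin G A a L l R r)
    (hR : BalancedContext G m R r ∅ c) : BalancedContext G m A a L l := by
  obtain ⟨hd, rfl, ⟨S, hS⟩, f, hl, hr⟩ := h
  rw [BalancedContext, Set.union_sdiff_cancel_left hd.le_bot]
  rw [BalancedContext, Set.sdiff_empty] at hR
  refine hR.recolor (fun p => (f p.1, {i | ∃ y ∈ L, l y = i ∧ (i, p.1) ∈ S})) fun x hx => ?_
  refine Prod.ext (hr x hx) (Set.ext fun i => ?_)
  refine exists_congr fun y => and_congr_right fun hy => and_congr_right fun hi => ?_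
  rw [G.adj_comm, hS y hy x hx, hi]

theorem join {A L R : Set V} {a l r c : V → κ} (h : IsJoin G A a L l R r)
    (hL : BalancedContext G m L l ∅ c) (hR : BalancedContext G m R r ∅ c) :
    BalancedContext G (m + 1) A a ∅ c :=
  (of_isJoin h hR).trans hL h.isPart (.empty _ _ _ _)

theorem of_ncard_le_one [Finite V] (h : (A \ B).ncard ≤ 1) : BalancedContext G m A a B b := by
  rcases Set.ncard_le_one_iff_subsingleton.1 h |>.eq_empty_or_singleton with h | ⟨v, h⟩
  · exact Or.inl h
  · rw [BalancedContext, h]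
    exact .inr (.single _ _ _)

theorem mono {m' : ℕ} (h : BalancedContext G m A a B b) (hm : m ≤ m') :
    BalancedContext G m' A a B b :=
  TaggedBuilt.mono h hm

end BalancedContext

/-! ### Balancing by heavy nodes -/

/-- There is a tree that builds `(A, a)` and has a subtree that builds `(B, b)`. -/
inductive Chain {V κ : Type*} (G : SimpleGraph V) (B : Set V) (b : V → κ) :
    Set V → (V → κ) → Prop
  | refl : Chain G B b B b
  | step {d : ℕ} {A L R : Set V} {a l r : V → κ} (h : IsJoin G A a L l R r)
      (hR : Built G d R r) (hL : Chain G B b L l) : Chain G B b A a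

theorem Chain.isPart {V κ : Type*} {G : SimpleGraph V} {A B : Set V} {a b : V → κ}
    (h : Chain G B b A a) : IsPart G A a B b := by
  induction h with
  | refl => exact .refl _ _ _
  | step h _ _ ih => exact h.isPart.trans ih

/-- Descend into a child with more than `m` vertices as long as there is one. -/
theorem Built.exists_heavy {V κ : Type*} {G : SimpleGraph V} {d m : ℕ} {A : Set V} {a : V → κ}
    (h : Built G d A a) (hm : 1 ≤ m) (hA : m < A.ncard) :
    ∃ U u L l R r e, Chain G U u A a ∧ IsJoin G U u L l R r ∧ Built G e L l ∧ Built G e R r ∧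
      m < U.ncard ∧ L.ncard ≤ m ∧ R.ncard ≤ m := by
  induction h with
  | single d v c => rw [Set.ncard_singleton] at hA; omega
  | @join d A L R a l r h hl hr ihl ihr =>
    by_cases hL : m < L.ncard
    · obtain ⟨U, u, L', l', R', r', e, hc, hrest⟩ := ihl hL
      exact ⟨U, u, L', l', R', r', e, .step h hr hc, hrest⟩
    by_cases hR : m < R.ncard
    · obtain ⟨U, u, L', l', R', r', e, hc, hrest⟩ := ihr hR
      exact ⟨U, u, L', l', R', r', e, .step h.symm hl hc, hrest⟩
    exact ⟨A, a, L, l, R, r, d, .refl, h, hl, hr, hA, not_lt.1 hL, not_lt.1 hR⟩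

theorem Chain.exists_heavy {V κ : Type*} {G : SimpleGraph V} {m : ℕ} {A B : Set V} {a b : V → κ}
    (h : Chain G B b A a) (hA : m < (A \ B).ncard) :
    ∃ U u L l R r e, Chain G U u A a ∧ IsJoin G U u L l R r ∧ Built G e R r ∧ Chain G B b L l ∧
      m < (U \ B).ncard ∧ (L \ B).ncard ≤ m := by
  induction h with
  | refl => simp at hA
  | @step d A L R a l r h hR hL ih =>
    by_cases hm : m < (L \ B).ncard
    · obtain ⟨U, u, L', l', R', r', e, hc, hrest⟩ := ih hm
      exact ⟨U, u, L', l', R', r', e, .step h hR hc, hrest⟩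
    exact ⟨A, a, L, l, R, r, d, .refl, h, hR, hL, hA, not_lt.1 hm⟩

/-- Whole trees are contexts of `∅`. Trees and contexts are balanced together: a heavy node splits a
tree into a context and two subtrees of half size, and splits a context into two contexts of half
size and a sibling tree. That tree need not be halved, but the bound for trees of size `2 ^ (h + 1)`
is already available. -/
theorem balancedContext_of_ncard_le {V κ : Type*} [Finite V] (G : SimpleGraph V) (c : V → κ)
    (h : ℕ) :
    (∀ (d : ℕ) (A : Set V) (a : V → κ), Built G d A a → A.ncard ≤ 2 ^ h →
      BalancedContext G (3 * h) A a ∅ c) ∧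
    ∀ (A B : Set V) (a b : V → κ), Chain G B b A a → (A \ B).ncard ≤ 2 ^ h →
      BalancedContext G (3 * h + 2) A a B b := by
  induction h with
  | zero =>
    exact ⟨fun d A a _ hA => .of_ncard_le_one (by simpa using hA),
      fun A B a b _ hA => .of_ncard_le_one (by simpa using hA)⟩
  | succ h ih =>
    obtain ⟨ih₁, ih₂⟩ := ih
    have tree : ∀ (d : ℕ) (A : Set V) (a : V → κ), Built G d A a → A.ncard ≤ 2 ^ (h + 1) →
        BalancedContext G (3 * (h + 1)) A a ∅ c := by
      intro d A a hA hcard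
      by_cases hle : A.ncard ≤ 2 ^ h
      · exact (ih₁ d A a hA hle).mono (by omega)
      obtain ⟨U, u, L, l, R, r, e, hc, hj, hL, hR, hU, hLm, hRm⟩ :=
        hA.exists_heavy Nat.one_le_two_pow (not_le.1 hle)
      have hAU : (A \ U).ncard ≤ 2 ^ h := by
        have := Set.ncard_sdiff_add_ncard_of_subset hc.isPart.subset
        rw [pow_succ] at hcard
        omega
      -- Depth: the context and the join of the two children each fit in `3 * h + 2`, and composing
      -- adds one.
      exact (ih₂ A U a u hc hAU).trans
        ((BalancedContext.join hj (ih₁ e L l hL hLm) (ih₁ e R r hR hRm)).mono (by omega))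
        hc.isPart (.empty _ _ _ _)
    refine ⟨tree, fun A B a b hAB hcard => ?_⟩
    by_cases hle : (A \ B).ncard ≤ 2 ^ h
    · exact (ih₂ A B a b hAB hle).mono (by omega)
    obtain ⟨U, u, L, l, R, r, e, hc, hj, hR, hL, hU, hLm⟩ := hAB.exists_heavy (not_le.1 hle)
    have hUB := (hj.isPart.trans hL.isPart).subset
    have hAU : (A \ U).ncard ≤ 2 ^ h := by
      have h₁ := Set.ncard_sdiff_add_ncard_of_subset hc.isPart.subset
      have h₂ := Set.ncard_sdiff_add_ncard_of_subset hUB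
      have h₃ := Set.ncard_sdiff_add_ncard_of_subset hAB.isPart.subset
      rw [pow_succ] at hcard
      omega
    have hRA : R ⊆ A \ B := by
      refine fun x hx => ⟨hc.isPart.subset ?_, fun hxB => ?_⟩
      · rw [hj.union_eq]; exact .inr hx
      · exact Set.disjoint_left.1 hj.disjoint (hL.isPart.subset hxB) hx
    have hRm : R.ncard ≤ 2 ^ (h + 1) := (Set.ncard_le_ncard hRA).trans hcard
    have hUL : BalancedContext G (3 * (h + 1)) U u L l := .of_isJoin hj (tree e R r hR hRm)
    -- The sibling has depth `3 * h + 3`, and two compositions give `3 * (h + 1) + 2`.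
    exact ((ih₂ A U a u hc hAU).mono (by omega)).trans
      (hUL.trans ((ih₂ L B l b hL hLm).mono (by omega)) hj.isPart hL.isPart) hc.isPart
      (hj.isPart.trans hL.isPart)

theorem Built.exists_balanced {V : Type*} [Finite V] {k d : ℕ} {G : SimpleGraph V} {a : V → Fin k}
    (h : Built G d Set.univ a) :
    ∃ c : V → Fin (k * 2 ^ (k + 1)), Built G (3 * Nat.clog 2 (Nat.card V)) Set.univ c := by
  have hb := (balancedContext_of_ncard_le G a (Nat.clog 2 (Nat.card V))).1 d Set.univ a h
    (by rw [Set.ncard_univ]; exact Nat.le_pow_clog Nat.one_lt_two _)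
  rw [BalancedContext, Set.sdiff_empty] at hb
  have hb' := hb.resolve_left h.nonempty.ne_empty
  -- Tag, color and profile.
  have hcard : Nat.card (Bool × Fin k × Set (Fin k)) = k * 2 ^ (k + 1) := by
    simp [Nat.card_eq_fintype_card]
    ring
  exact ⟨_, hb'.mapEquiv (Finite.equivFinOfCardEq hcard)⟩

/-! ### Connected components of induced subgraphs -/

/-- `K` is the vertex set of a connected component of the subgraph of `G` induced on `A`. -/
structure IsComponentOf {V : Type*} (G : SimpleGraph V) (A K : Set V) : Prop where
  subset : K ⊆ A
  connected : (G.induce K).Connected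
  closed : ∀ x ∈ K, ∀ y ∈ A, G.Adj x y → y ∈ K

theorem SimpleGraph.Connected.subset_of_closed {V : Type*} {G : SimpleGraph V} {J K : Set V}
    (hJ : (G.induce J).Connected) {x : V} (hxJ : x ∈ J) (hxK : x ∈ K)
    (h : ∀ y ∈ K, ∀ z ∈ J, G.Adj y z → z ∈ K) : J ⊆ K := by
  intro y hy
  obtain ⟨p⟩ := hJ.preconnected ⟨x, hxJ⟩ ⟨y, hy⟩
  have key : ∀ u v : J, (G.induce J).Walk u v → (u : V) ∈ K → (v : V) ∈ K := by
    intro u v p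
    induction p with
    | nil => exact id
    | cons hadj _ ih => exact fun hu => ih (h _ hu _ (Subtype.coe_prop _) hadj)
  exact key _ _ p hxK

namespace IsComponentOf

variable {V : Type*} {G : SimpleGraph V} {A J K L W : Set V}

theorem exists_mem (G : SimpleGraph V) {x : V} (hx : x ∈ A) : ∃ K, IsComponentOf G A K ∧ x ∈ K := by
  set C := (G.induce A).connectedComponentMk ⟨x, hx⟩ with hC
  refine ⟨Subtype.val '' C.supp, ⟨?_, ?_, ?_⟩, ⟨⟨x, hx⟩, rfl, rfl⟩⟩
  · rintro _ ⟨y, _, rfl⟩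
    exact y.2
  · have hconn : ((G.induce A).induce C.supp).Connected := C.connected_toSimpleGraph
    let f : (G.induce A).induce C.supp →g G.induce (Subtype.val '' C.supp) :=
      ⟨fun y => ⟨y.1.1, y.1, y.2, rfl⟩, fun h => h⟩
    refine hconn.map f ?_
    rintro ⟨_, y, hy, rfl⟩
    exact ⟨⟨y, hy⟩, rfl⟩
  · rintro _ ⟨y, hy, rfl⟩ z hz hyz
    exact ⟨⟨z, hz⟩, C.mem_supp_of_adj_mem_supp hy hyz, rfl⟩

theorem nonempty (h : IsComponentOf G A K) : K.Nonempty :=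
  Set.nonempty_coe_sort.1 h.connected.nonempty

theorem subset_of_mem (hJ : IsComponentOf G L J) {x : V} (hxJ : x ∈ J) (hxW : x ∈ W)
    (hW : ∀ y ∈ W, ∀ z ∈ L, G.Adj y z → z ∈ W) : J ⊆ W :=
  hJ.connected.subset_of_closed hxJ hxW fun y hy z hz => hW y hy z (hJ.subset hz)

theorem eq_of_mem (hJ : IsComponentOf G A J) (hK : IsComponentOf G A K) {x : V} (hxJ : x ∈ J)
    (hxK : x ∈ K) : J = K :=
  (hJ.subset_of_mem hxJ hxK hK.closed).antisymm (hK.subset_of_mem hxK hxJ hJ.closed)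

end IsComponentOf

/-! ### Building NLC₊ trees component by component -/

/-- The subgraph of `G` induced on `A`, colored by `c`, has an NLC₊-decomposition tree of depth at
most `d`. -/
def PlusBuilt {V : Type*} {k : ℕ} (G : SimpleGraph V) (d : ℕ) (A : Set V) (c : V → Fin k) : Prop :=
  ∃ T : NLCPlusTree k, T.IsDecomposition ∧ T.depth ≤ d ∧ RealizedOn T.graph T.color G A c

/-- As `PlusBuilt`, with a tree whose root is not labeled `∥`. -/
def PlusBuiltConnected {V : Type*} {k : ℕ} (G : SimpleGraph V) (d : ℕ) (A : Set V)
    (c : V → Fin k) : Prop :=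
  ∃ T : NLCPlusTree k, ¬ T.IsParallel ∧ T.IsDecomposition ∧ T.depth ≤ d ∧
    RealizedOn T.graph T.color G A c

theorem RealizedOn.connected {X V κ : Type*} {H : SimpleGraph X} {col : X → κ} {G : SimpleGraph V}
    {A : Set V} {c : V → κ} (h : RealizedOn H col G A c) (hA : (G.induce A).Connected) :
    H.Connected := by
  obtain ⟨e, rfl, -⟩ := h
  let φ : H ≃g G.induce (Set.range e) := ⟨Equiv.ofInjective e e.injective, e.map_adj_iff⟩
  exact φ.connected_iff.2 hA

theorem RealizedOn.parallel {V κ : Type*} {ι : Type} {X : ι → Type} {H : ∀ i, SimpleGraph (X i)}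
    {col : ∀ i, X i → κ} {G : SimpleGraph V} {A : ι → Set V} {c : V → κ}
    (h : ∀ i, RealizedOn (H i) (col i) G (A i) c)
    (hA : ∀ i j, i ≠ j → ∀ x ∈ A i, ∀ y ∈ A j, x ≠ y ∧ ¬ G.Adj x y) :
    RealizedOn (parallelGraph H) (fun x => col x.1 x.2) G (⋃ i, A i) c := by
  choose e he hcol using h
  have hmem : ∀ i x, e i x ∈ A i := fun i x => he i ▸ Set.mem_range_self x
  refine ⟨⟨⟨fun x => e x.1 x.2, ?_⟩, ?_⟩, ?_, fun x => hcol _ _⟩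
  · rintro ⟨i, x⟩ ⟨j, y⟩ hxy
    obtain rfl : i = j := by
      by_contra hij
      exact (hA i j hij _ (hmem i x) _ (hmem j y)).1 hxy
    exact congrArg (Sigma.mk i) ((e i).injective hxy)
  · rintro ⟨i, x⟩ ⟨j, y⟩
    change G.Adj (e i x) (e j y) ↔ ∃ l a b, _ = _ ∧ _ = _ ∧ _
    constructor
    · intro hxy
      obtain rfl : i = j := by
        by_contra hij
        exact (hA i j hij _ (hmem i x) _ (hmem j y)).2 hxy
      exact ⟨i, x, y, rfl, rfl, (e i).map_adj_iff.1 hxy⟩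
    · rintro ⟨l, a, b, hx, hy, hab⟩
      cases hx
      cases hy
      exact (e i).map_adj_iff.2 hab
  · ext v
    simp only [Set.mem_iUnion, ← he]
    exact ⟨fun ⟨x, hx⟩ => ⟨x.1, x.2, hx⟩, fun ⟨i, x, hx⟩ => ⟨⟨i, x⟩, hx⟩⟩

namespace PlusBuiltConnected

variable {V : Type*} {k d : ℕ} {G : SimpleGraph V} {A : Set V} {c : V → Fin k}

theorem mono {d' : ℕ} (h : PlusBuiltConnected G d A c) (hd : d ≤ d') :
    PlusBuiltConnected G d' A c := by
  obtain ⟨T, h₁, h₂, h₃, h₄⟩ := h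
  exact ⟨T, h₁, h₂, h₃.trans hd, h₄⟩

/-- A `∥` node carries no recoloring, so a root of another kind is essential here. -/
theorem recolor {c' : V → Fin k} (h : PlusBuiltConnected G d A c) (g : Fin k → Fin k)
    (hg : ∀ x ∈ A, c' x = g (c x)) : PlusBuiltConnected G d A c' := by
  obtain ⟨T, hp, hT, hd, e, rfl, he⟩ := h
  have hc : ∀ x, g (T.color x) = c' (e x) := fun x => by rw [he, hg _ (Set.mem_range_self x)]
  cases T with
  | newVertex i => exact ⟨.newVertex (g i), hp, trivial, hd, e, rfl, hc⟩
  | join S f l r =>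
    refine ⟨.join S (g ∘ f) l r, id, hT, hd, e, rfl, ?_⟩
    rintro (x | x)
    exacts [hc (Sum.inl x), hc (Sum.inr x)]
  | parallel p child => exact absurd trivial hp

theorem plusBuilt (h : PlusBuiltConnected G d A c) : PlusBuilt G d A c := by
  obtain ⟨T, -, h⟩ := h
  exact ⟨T, h⟩

end PlusBuiltConnected

namespace PlusBuilt

variable {V : Type*} {k d : ℕ} {G : SimpleGraph V}

theorem join {P L R : Set V} {p l r : V → Fin k} (hL : PlusBuilt G d L l) (hR : PlusBuilt G d R r)
    (hP : IsJoin G P p L l R r) (hconn : (G.induce P).Connected) :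
    PlusBuiltConnected G (d + 1) P p := by
  obtain ⟨hd, hu, ⟨S, hS⟩, f, hfl, hfr⟩ := hP
  obtain ⟨T, hT, hTd, hTr⟩ := hL
  obtain ⟨U, hU, hUd, hUr⟩ := hR
  have hreal := RealizedOn.join hd hu hS hfl hfr hTr hUr
  exact ⟨.join S f T U, id, ⟨hreal.connected hconn, hT, hU⟩, Nat.succ_le_succ (max_le hTd hUd),
    hreal⟩

theorem parallel {p : ℕ} (hp : 2 ≤ p) {A : Fin p → Set V} {c : V → Fin k}
    (h : ∀ i, PlusBuiltConnected G d (A i) c)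
    (hA : ∀ i j, i ≠ j → ∀ x ∈ A i, ∀ y ∈ A j, x ≠ y ∧ ¬ G.Adj x y) :
    PlusBuilt G (d + 1) (⋃ i, A i) c := by
  choose T hT hdec hd hreal using h
  exact ⟨.parallel p T, ⟨hp, fun j => ⟨hT j, hdec j⟩⟩,
    Nat.succ_le_succ (Finset.sup_le fun j _ => hd j), RealizedOn.parallel hreal hA⟩

/-- A set closed under adjacency within `L` is a union of components of `L`, which become the
children of a `∥` node. -/
theorem of_components [Finite V] {L W : Set V} {c : V → Fin k}
    (h : ∀ J, IsComponentOf G L J → PlusBuiltConnected G d J c) (hWL : W ⊆ L) (hW : W.Nonempty)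
    (hclosed : ∀ y ∈ W, ∀ z ∈ L, G.Adj y z → z ∈ W) : PlusBuilt G (d + 1) W c := by
  let ι := {J : Set V // IsComponentOf G L J ∧ J ⊆ W}
  obtain ⟨p, ⟨φ⟩⟩ := Finite.exists_equiv_fin ι
  have hunion : W = ⋃ i : Fin p, (φ.symm i).1 := by
    refine Set.Subset.antisymm (fun x hx => ?_) (Set.iUnion_subset fun i => (φ.symm i).2.2)
    obtain ⟨J, hJ, hxJ⟩ := IsComponentOf.exists_mem G (hWL hx)
    refine Set.mem_iUnion.2 ⟨φ ⟨J, hJ, hJ.subset_of_mem hxJ hx hclosed⟩, ?_⟩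
    rw [φ.symm_apply_apply]
    exact hxJ
  by_cases hp : 2 ≤ p
  · rw [hunion]
    refine parallel hp (fun i => h _ (φ.symm i).2.1) fun i j hij x hx y hy => ?_
    have hne : (φ.symm i).1 ≠ (φ.symm j).1 := fun h' => hij (φ.symm.injective (Subtype.ext h'))
    refine ⟨fun hxy => hne ?_, fun hxy => hne ?_⟩
    · exact (φ.symm i).2.1.eq_of_mem (φ.symm j).2.1 hx (hxy ▸ hy)
    · exact (φ.symm i).2.1.eq_of_mem (φ.symm j).2.1
        ((φ.symm i).2.1.closed x hx y ((φ.symm j).2.1.subset hy) hxy) hy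
  -- With a single component a `∥` node is not allowed, and its tree is used directly.
  · obtain ⟨x, hx⟩ := hW
    rw [hunion] at hx
    obtain ⟨i, hi⟩ := Set.mem_iUnion.1 hx
    have : W = (φ.symm i).1 := by
      refine hunion.trans (Set.Subset.antisymm (Set.iUnion_subset fun j => ?_)
        (Set.subset_iUnion (fun i => (φ.symm i).1) i))
      rw [show j = i from Fin.ext (by omega)]
    rw [this]
    exact ((h _ (φ.symm i).2.1).mono (Nat.le_succ d)).plusBuilt

end PlusBuilt

/-- If `K` meets both sides, its two traces are built from components and joined, which adds two
levels. If `K` lies in one side, it is a component there and only a recoloring is needed. -/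
theorem Built.plusBuiltConnected {V : Type*} [Finite V] {k d : ℕ} {G : SimpleGraph V} {A K : Set V}
    {a : V → Fin k} (h : Built G d A a) (hK : IsComponentOf G A K) :
    PlusBuiltConnected G (2 * d) K a := by
  induction h generalizing K with
  | single d v c =>
    obtain rfl : K = {v} := (Set.subset_singleton_iff_eq.1 hK.subset).resolve_left
      hK.nonempty.ne_empty
    exact ⟨.newVertex (c v), id, trivial, Nat.zero_le _, RealizedOn.single G v c⟩
  | @join d A L R a l r h _ _ ihl ihr =>
    obtain ⟨hd, rfl, ⟨S, hS⟩, f, hl, hr⟩ := h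
    have hKL : K = K ∩ L ∪ K ∩ R := by
      rw [← Set.inter_union_distrib_left, Set.inter_eq_left.2 hK.subset]
    by_cases hneL : (K ∩ L).Nonempty
    · by_cases hneR : (K ∩ R).Nonempty
      · refine PlusBuilt.join (d := 2 * d + 1)
          (PlusBuilt.of_components (fun J hJ => ihl hJ) Set.inter_subset_right hneL ?_)
          (PlusBuilt.of_components (fun J hJ => ihr hJ) Set.inter_subset_right hneR ?_)
          ⟨hd.mono Set.inter_subset_right Set.inter_subset_right, hKL,
            ⟨S, fun x hx y hy => hS x hx.2 y hy.2⟩, f, fun x hx => hl x hx.2,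
            fun x hx => hr x hx.2⟩ hK.connected
        · exact fun y hy z hz hyz => ⟨hK.closed y hy.1 z (.inl hz) hyz, hz⟩
        · exact fun y hy z hz hyz => ⟨hK.closed y hy.1 z (.inr hz) hyz, hz⟩
      · have hsub : K ⊆ L := by
          rw [Set.not_nonempty_iff_eq_empty.1 hneR, Set.union_empty] at hKL
          exact Set.inter_eq_left.1 hKL.symm
        exact ((ihl ⟨hsub, hK.connected, fun x hx y hy => hK.closed x hx y (.inl hy)⟩).recolor f
          fun x hx => hl x (hsub hx)).mono (by omega)
    · have hsub : K ⊆ R := by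
        rw [Set.not_nonempty_iff_eq_empty.1 hneL, Set.empty_union] at hKL
        exact Set.inter_eq_left.1 hKL.symm
      exact ((ihr ⟨hsub, hK.connected, fun x hx y hy => hK.closed x hx y (.inr hy)⟩).recolor f
        fun x hx => hr x (hsub hx)).mono (by omega)

theorem Built.plusBuilt_univ {V : Type*} [Finite V] {k d : ℕ} {G : SimpleGraph V} {a : V → Fin k}
    (h : Built G d Set.univ a) (hG : G.Connected) : PlusBuilt G (2 * d) Set.univ a :=
  (h.plusBuiltConnected ⟨subset_rfl, (SimpleGraph.induceUnivIso G).connected_iff.2 hG,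
    fun _ _ _ hy _ => hy⟩).plusBuilt

/-! ### Return to isomorphisms and the logarithmic bound -/

theorem RealizedOn.of_iso {X V κ : Type*} {H : SimpleGraph X} {G : SimpleGraph V} (col : X → κ)
    (e : H ≃g G) : RealizedOn H col G Set.univ (fun v => col (e.symm v)) :=
  ⟨e.toEmbedding, e.surjective.range_eq, fun x => congrArg col (e.symm_apply_apply x).symm⟩

theorem RealizedOn.exists_iso {X V κ : Type*} {H : SimpleGraph X} {G : SimpleGraph V} {col : X → κ}
    {c : V → κ} (h : RealizedOn H col G Set.univ c) :
    ∃ e : H ≃g G, ∀ v, col (e.symm v) = c v := by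
  obtain ⟨e, he, hcol⟩ := h
  let φ : H ≃g G := RelIso.ofSurjective e (Set.range_eq_univ.1 he)
  exact ⟨φ, fun v => (hcol _).trans (congrArg c (φ.apply_symm_apply v))⟩

instance NLCTree.finite_leaf {k : ℕ} (T : NLCTree k) : Finite T.Leaf := by
  induction T with
  | newVertex i => exact inferInstanceAs (Finite Unit)
  | join S R l r ihl ihr => exact inferInstanceAs (Finite (l.Leaf ⊕ r.Leaf))

theorem Nat.clog_two_le_log (n : ℕ) : (Nat.clog 2 n : ℝ) ≤ 2 / Real.log 2 * Real.log n := by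
  have h2 : 0 < Real.log 2 := Real.log_pos one_lt_two
  rcases le_or_gt n 1 with hn | hn
  · rw [Nat.clog_of_right_le_one hn, Nat.cast_zero]
    positivity
  · have hpow : 2 ^ (Nat.clog 2 n).pred < n := Nat.pow_pred_clog_lt_self Nat.one_lt_two hn
    have hpos := Nat.clog_pos Nat.one_lt_two hn
    -- The bound is `2 * 2 ^ (clog - 1) ≤ 2 * n ≤ n ^ 2`, using `2 ≤ n`.
    have hsq : 2 ^ Nat.clog 2 n ≤ n ^ 2 := by
      obtain ⟨m, hm⟩ : ∃ m, Nat.clog 2 n = m + 1 := ⟨Nat.clog 2 n - 1, by omega⟩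
      rw [hm, Nat.pred_succ] at hpow
      rw [hm, pow_succ, sq]
      exact Nat.mul_le_mul hpow.le hn
    have hlog : Real.log ((2 : ℝ) ^ Nat.clog 2 n) ≤ Real.log ((n : ℝ) ^ 2) :=
      Real.log_le_log (by positivity) (by exact_mod_cast hsq)
    rw [Real.log_pow, Real.log_pow] at hlog
    rw [div_mul_eq_mul_div, le_div_iff₀ h2]
    exact_mod_cast hlog

theorem mainTheorem5 :
    (∃ C : ℝ, ∀ k : ℕ, 1 ≤ k → ∀ (V : Type*) [Fintype V] (G : SimpleGraph V),
      G.Connected → nlcWidth G = k →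
        ∃ w : ℕ, w ≤ k * 2 ^ (k + 1) ∧ ∃ T : NLCPlusTree w,
          T.IsDecomposition ∧ Nonempty (T.graph ≃g G) ∧
            (T.depth : ℝ) ≤ C * Real.log (Fintype.card V)) ∧
    (∀ (V : Type*) (G : SimpleGraph V), G.Connected →
      ∀ (w : ℕ) (T : NLCTree w) (e : T.graph ≃g G),
        ∃ T' : NLCPlusTree w, T'.IsDecomposition ∧ T'.depth ≤ 2 * T.depth ∧
          ∃ e' : T'.graph ≃g G, ∀ v : V, T'.color (e'.symm v) = T.color (e.symm v)) := by
  -- The constant is 3 from balancing, 2 from the `∥` levels and `2 / Real.log 2` from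
  -- `Nat.clog_two_le_log`.
  refine ⟨⟨12 / Real.log 2, fun k hk V _ G hG hw => ?_⟩, fun V G hG w T e => ?_⟩
  -- As `sInf ∅ = 0`, the bound `1 ≤ k` guarantees that the width is attained by a tree.
  · have hne : {k | ∃ T : NLCTree k, Nonempty (T.graph ≃g G)}.Nonempty :=
      Nat.nonempty_of_pos_sInf (by change 0 < nlcWidth G; omega)
    obtain ⟨T, ⟨e⟩⟩ : ∃ T : NLCTree k, Nonempty (T.graph ≃g G) := hw ▸ Nat.sInf_mem hne
    obtain ⟨c, hc⟩ := (T.built (RealizedOn.of_iso T.color e)).exists_balanced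
    obtain ⟨T', hT', hd, hreal⟩ := hc.plusBuilt_univ hG
    obtain ⟨e', -⟩ := hreal.exists_iso
    refine ⟨_, le_rfl, T', hT', ⟨e'⟩, ?_⟩
    have hlog := Nat.clog_two_le_log (Fintype.card V)
    rw [Nat.card_eq_fintype_card] at hd
    calc (T'.depth : ℝ) ≤ 6 * Nat.clog 2 (Fintype.card V) := by
          exact_mod_cast hd.trans (by omega)
      _ ≤ 6 * (2 / Real.log 2 * Real.log (Fintype.card V)) := by gcongr
      _ = 12 / Real.log 2 * Real.log (Fintype.card V) := by ring
  · have : Finite V := Finite.of_equiv _ e.toEquiv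
    obtain ⟨T', hT', hd, hreal⟩ :=
      (T.built (RealizedOn.of_iso T.color e)).plusBuilt_univ hG
    exact ⟨T', hT', hd, hreal.exists_iso⟩
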